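/- **Proposition (mutual inequivalence and disjointness of the fibre representations of the BEC state).** *Setting.* Let $d,N\ge 1$, $\beta>0$, and let $\omega(k)=w(|k|)$ on $\mathbb R^d$, where $w:[0,\infty)\to[0,\infty)$ is $C^1$ with $w'>0$, $w(s)\to\infty$ as $s\to\infty$, $\sup_{s\ge0}(1+s)^{d_0}e^{-\beta w(s)}<\infty$ for some $d_0>d$, and $\int_{|k|\le1}\frac{dk}{\omega(k)-\omega(0)}<\infty$. Let $\mu\le\omega(0)$ (the condensed phase of massless phonons is $\mu=\omega(0)=0$), and let $\bar\rho>\rho_c:=\frac{N}{(2\pi)^d}\int_{\mathbb R^d}\frac{dk}{e^{\beta(\omega(k)-\omega(0))}-1}$, so that the condensate density $\rho_0:=\bar\rho-\rho_c$ is positive; put $c:=2(2\pi)^d\rho_0/N$. For a Hilbert space $\mathcal K$ let $\mathcal F_b(\mathcal K)=\bigoplus_{n\ge0}\bigotimes_s^n\mathcal K$ be the bosonic Fock space, $\phi(g)=\frac1{\sqrt2}\,\overline{a(g)+a(g)^*}$ the Segal field operator and $W(g)=e^{i\phi(g)}$. Let $\mathcal H=L^2(\mathbb R^d;\mathbb C^N)$,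 let $C$ be componentwise complex conjugation on $\mathcal H$, let functions of $\omega$ act on $\mathcal H$ as multiplication operators in momentum space, and let $\rho=(e^{\beta(\omega-\mu)}-1)^{-1}$. Put $$\mathcal D=L^1(\mathbb R^d;\mathbb C^N)\cap\operatorname{dom}\,(1-e^{-\beta(\omega-\mu)})^{-1/2}\cap\operatorname{dom}\,\omega^{-1/2},$$ and define the left Araki–Woods Weyl operators on $\mathcal F^{AW}=\mathcal F_b(\mathcal H\oplus\mathcal H)$ by $$W_{\beta,l}(f)=\exp\!\big(i\,\phi((1+\rho)^{1/2}f\oplus C\rho^{1/2}f)\big),\qquad f\in\mathcal D .$$ With $\hat f(0)=(2\pi)^{-d/2}\int f(x)\,dx\in\mathbb C^N$ and a fixed nonzero linear functional $\ell:\mathbb C^N\to\mathbb C$ (the identity if $N=1$), let $$e_f(r,\theta)=\exp\!\big[i\sqrt{c\,r}\;\mathrm{Re}\big(e^{i\theta}\ell(\hat f(0))\big)\big],\qquad \pi_b^{r,\theta}(W(f))=e_f(r,\theta)\,W_{\beta,l}(f),\qquad f\in\mathcal D .$$ *Claim.* Let $(r,\theta)\ne(r',\theta')$ be points of $[0,\infty)\times[0,2\pi]$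 that do not represent the same point in polar coordinates, i.e. not both $r=r'=0$, and not both $r=r'$ and $|\theta-\theta'|=2\pi$. Then: 1. $\pi_b^{r,\theta}$ and $\pi_b^{r',\theta'}$ are unitarily inequivalent: there is no unitary $U$ on $\mathcal F^{AW}$ with $U\,\pi_b^{r,\theta}(W(f))=\pi_b^{r',\theta'}(W(f))\,U$ for all $f\in\mathcal D$. 2. They are disjoint: every bounded operator $T$ on $\mathcal F^{AW}$ with $T\,\pi_b^{r,\theta}(W(f))=\pi_b^{r',\theta'}(W(f))\,T$ for all $f\in\mathcal D$ is zero. 3. Consequently, any $*$-representations of the $*$-algebra generated by $\{W(f):f\in\mathcal D\}$ on $\mathcal F_b(\mathcal H)$ taking these values on the generators $W(f)$ are not unitarily equivalent. -/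

import Mathlib

open scoped TensorProduct

noncomputable section

namespace BosonFock

/-- A complex Hilbert space, bundled so that tensor powers can be formed by recursion. -/
structure HilbertObj where
  carrier : Type
  [normed : NormedAddCommGroup carrier]
  [innerProduct : InnerProductSpace ℂ carrier]
  [complete : CompleteSpace carrier]

attribute [instance] HilbertObj.normed HilbertObj.innerProduct HilbertObj.complete

section Fock

variable (K : Type) [NormedAddCommGroup K] [InnerProductSpace ℂ K]

/-- The `n`-fold Hilbert tensor power: `ℂ` for `n = 0`, and the completion of
`K ⊗ (n-fold tensor power)` for `n + 1`. -/
def tensorPowerObj : ℕ → HilbertObj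
  | 0 => ⟨ℂ⟩
  | n + 1 => ⟨UniformSpace.Completion (K ⊗[ℂ] (tensorPowerObj n).carrier)⟩

/-- The Hilbert space `K ⊗ ⋯ ⊗ K` (`n` factors). -/
abbrev TensorPow (n : ℕ) : Type := (tensorPowerObj K n).carrier

variable {K}

/-- The pure tensor `v 0 ⊗ ⋯ ⊗ v (n - 1)`. -/
def tprod : (n : ℕ) → (Fin n → K) → TensorPow K n
  | 0, _ => (1 : ℂ)
  | n + 1, v =>
    ((v 0 ⊗ₜ[ℂ] tprod n (fun i => v i.succ) : K ⊗[ℂ] TensorPow K n) :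
      UniformSpace.Completion (K ⊗[ℂ] TensorPow K n))

/-- The unnormalised symmetrisation of the pure tensor of `v`. -/
def symTprod (n : ℕ) (v : Fin n → K) : TensorPow K n :=
  ∑ σ : Equiv.Perm (Fin n), tprod n (fun i => v (σ i))

variable (K) in
/-- The symmetric tensor power: the closed linear span of the symmetrised pure tensors, that is,
the range of the orthogonal projection onto permutation-invariant tensors. -/
def SymPow (n : ℕ) : Submodule ℂ (TensorPow K n) :=
  (Submodule.span ℂ (Set.range (symTprod (K := K) n))).topologicalClosure

instance (n : ℕ) : CompleteSpace (SymPow K n) :=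
  (Submodule.isClosed_topologicalClosure _).completeSpace_coe

/-- The contraction `v 0 ⊗ v 1 ⊗ ⋯ ⊗ v n ↦ ⟪f, v 0⟫ • (v 1 ⊗ ⋯ ⊗ v n)` on the algebraic tensor
product. -/
def contractAlg (n : ℕ) (f : K) : K ⊗[ℂ] TensorPow K n →L[ℂ] TensorPow K n :=
  (TensorProduct.lidIsometry ℂ (TensorPow K n)).toContinuousLinearEquiv.toContinuousLinearMap ∘L
    TensorProduct.mapL (innerSL ℂ f) (ContinuousLinearMap.id ℂ (TensorPow K n))

/-- The contraction with `f` in the first tensor factor, on the completed tensor power. -/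
def contract (n : ℕ) (f : K) : TensorPow K (n + 1) →L[ℂ] TensorPow K n :=
  (contractAlg n f).extend (UniformSpace.Completion.toComplL (𝕜 := ℂ) (E := K ⊗[ℂ] TensorPow K n))

theorem contract_coe (n : ℕ) (f : K) (x : K ⊗[ℂ] TensorPow K n) :
    contract n f (x : UniformSpace.Completion (K ⊗[ℂ] TensorPow K n)) = contractAlg n f x :=
  ContinuousLinearMap.extend_eq (contractAlg n f)
    (e := UniformSpace.Completion.toComplL (𝕜 := ℂ) (E := K ⊗[ℂ] TensorPow K n))
    UniformSpace.Completion.denseRange_coe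
    (UniformSpace.Completion.isUniformInducing_coe _) x

theorem contract_tprod (n : ℕ) (f : K) (v : Fin (n + 1) → K) :
    contract n f (tprod (n + 1) v) = inner ℂ f (v 0) • tprod n (fun i => v i.succ) := by
  have h := contract_coe n f (v 0 ⊗ₜ[ℂ] tprod n (fun i => v i.succ))
  refine h.trans ?_
  simp [contractAlg]

theorem norm_contract_le (n : ℕ) (f : K) : ‖contract n f‖ ≤ ‖f‖ := by
  have h1 : ‖contractAlg n f‖ ≤ ‖f‖ := by
    refine ContinuousLinearMap.opNorm_le_bound _ (norm_nonneg _) fun x => ?_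
    have h2 : ‖contractAlg n f x‖ =
        ‖TensorProduct.mapL (innerSL ℂ f) (ContinuousLinearMap.id ℂ (TensorPow K n)) x‖ :=
      (TensorProduct.lidIsometry ℂ (TensorPow K n)).norm_map _
    rw [h2]
    refine (ContinuousLinearMap.le_opNorm _ _).trans ?_
    refine mul_le_mul_of_nonneg_right ?_ (norm_nonneg _)
    refine (TensorProduct.norm_mapL_le _ _).trans ?_
    rw [innerSL_apply_norm]
    exact mul_le_of_le_one_right (norm_nonneg _) ContinuousLinearMap.norm_id_le
  have h3 := ContinuousLinearMap.opNorm_extend_le (N := 1) (contractAlg n f)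
    (e := UniformSpace.Completion.toComplL (𝕜 := ℂ) (E := K ⊗[ℂ] TensorPow K n))
    UniformSpace.Completion.denseRange_coe (fun x => by simp)
  refine h3.trans (by simpa using h1)

theorem contract_symTprod (n : ℕ) (f : K) (v : Fin (n + 1) → K) :
    contract n f (symTprod (n + 1) v) =
      ∑ p : Fin (n + 1), inner ℂ f (v p) • symTprod n (fun i => v (Equiv.swap 0 p i.succ)) := by
  unfold symTprod
  rw [map_sum, ← Equiv.sum_comp Equiv.Perm.decomposeFin.symm, Fintype.sum_prod_type]
  refine Finset.sum_congr rfl fun p _ => ?_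
  rw [Finset.smul_sum]
  refine Finset.sum_congr rfl fun e _ => ?_
  rw [contract_tprod]
  simp

theorem contract_mem (n : ℕ) (f : K) {x : TensorPow K (n + 1)} (hx : x ∈ SymPow K (n + 1)) :
    contract n f x ∈ SymPow K n := by
  have h : SymPow K (n + 1) ≤ (SymPow K n).comap (contract n f).toLinearMap := by
    refine Submodule.topologicalClosure_minimal _ ?_ ?_
    · rw [Submodule.span_le]
      rintro _ ⟨v, rfl⟩
      change contract n f (symTprod (n + 1) v) ∈ SymPow K n
      rw [contract_symTprod]
      exact Submodule.sum_mem _ fun p _ => Submodule.smul_mem _ _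
        (Submodule.le_topologicalClosure _ (Submodule.subset_span ⟨_, rfl⟩))
    · exact (Submodule.isClosed_topologicalClosure _).preimage (contract n f).continuous
  exact h hx

/-- The annihilation operator from the `(n+1)`-particle to the `n`-particle space,
`a(f) = √(n+1) ⟪f, ·⟫ ⊗ 1 ⊗ ⋯ ⊗ 1`. -/
def annihN (n : ℕ) (f : K) : SymPow K (n + 1) →L[ℂ] SymPow K n :=
  (Real.sqrt (n + 1) : ℂ) •
    ((contract n f ∘L (SymPow K (n + 1)).subtypeL).codRestrict (SymPow K n)
      (fun x => contract_mem n f x.2))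

/-- The creation operator from the `n`-particle to the `(n+1)`-particle space, the adjoint of
the annihilation operator. -/
def createN (n : ℕ) (f : K) : SymPow K n →L[ℂ] SymPow K (n + 1) :=
  ContinuousLinearMap.adjoint (annihN n f)

theorem norm_annihN_le (n : ℕ) (f : K) : ‖annihN n f‖ ≤ Real.sqrt (n + 1) * ‖f‖ := by
  refine ContinuousLinearMap.opNorm_le_bound _ (by positivity) fun x => ?_
  have h : ‖annihN n f x‖ = Real.sqrt (n + 1) * ‖contract n f (x : TensorPow K (n + 1))‖ := by
    simp only [annihN, smul_apply, norm_smul, Complex.norm_real]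
    rw [Real.norm_of_nonneg (Real.sqrt_nonneg _)]
    rfl
  rw [h, mul_assoc]
  refine mul_le_mul_of_nonneg_left ?_ (Real.sqrt_nonneg _)
  exact ((contract n f).le_opNorm _).trans
    (mul_le_mul_of_nonneg_right (norm_contract_le n f) (norm_nonneg _))

theorem norm_createN_le (n : ℕ) (f : K) : ‖createN n f‖ ≤ Real.sqrt (n + 1) * ‖f‖ := by
  rw [createN, LinearIsometryEquiv.norm_map]
  exact norm_annihN_le n f

variable (K) in
/-- The bosonic Fock space `⨁ₙ ⊗ₛⁿ K` (Hilbert space direct sum). -/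
abbrev Fock : Type := lp (fun n : ℕ => SymPow K n) 2

variable (K) in
/-- The finite-particle vectors. -/
def finiteParticle : Submodule ℂ (Fock K) where
  carrier := {ψ | {n : ℕ | ψ n ≠ 0}.Finite}
  zero_mem' := by simp
  add_mem' := by
    intro a b ha hb
    refine (ha.union hb).subset fun n hn => ?_
    by_contra h
    simp only [Set.mem_union, Set.mem_ofPred_eq, not_or, not_not] at h
    exact hn (by simp [h.1, h.2])
  smul_mem' := by
    intro c a ha
    refine ha.subset fun n hn h => hn ?_
    simp [h]

/-- A sequence with finitely many non-zero components, as a finite-particle vector. -/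
def ofFinite (ψ : ∀ n : ℕ, SymPow K n) (h : {n : ℕ | ψ n ≠ 0}.Finite) : finiteParticle K :=
  ⟨⟨ψ, memℓp_gen (summable_of_hasFiniteSupport
    (h.subset fun n hn h0 => hn (by simp [h0])))⟩, h⟩

/-- The annihilation operator `a(f)` on finite-particle vectors: `(a(f)ψ)ₙ = a(f) ψₙ₊₁`. -/
def annih (f : K) : finiteParticle K →ₗ[ℂ] finiteParticle K where
  toFun ψ := ofFinite (fun n => annihN n f (ψ.1 (n + 1))) (by
    refine (ψ.2.preimage (Set.injOn_of_injective (add_left_injective 1))).subset fun n hn h => ?_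
    exact hn (by
      have h' : ψ.1 (n + 1) = 0 := h
      simp [h']))
  map_add' ψ χ := by
    ext n : 3
    exact map_add (annihN n f) (ψ.1 (n + 1)) (χ.1 (n + 1))
  map_smul' c ψ := by
    ext n : 3
    exact map_smul (annihN n f) c (ψ.1 (n + 1))

/-- The components of `a(f)*ψ`: `(a(f)*ψ)₀ = 0` and `(a(f)*ψ)ₙ₊₁ = a(f)* ψₙ`. -/
def createSeq (f : K) (ψ : ∀ n : ℕ, SymPow K n) : ∀ n : ℕ, SymPow K n
  | 0 => 0
  | n + 1 => createN n f (ψ n)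

/-- The creation operator `a(f)*` on finite-particle vectors. -/
def create (f : K) : finiteParticle K →ₗ[ℂ] finiteParticle K where
  toFun ψ := ofFinite (createSeq f ψ.1) (by
    refine (ψ.2.image (· + 1)).subset fun n hn => ?_
    cases n with
    | zero => exact absurd rfl hn
    | succ n =>
      refine ⟨n, fun h => hn ?_, rfl⟩
      have h' : ψ.1 n = 0 := h
      simp [createSeq, h'])
  map_add' ψ χ := by
    ext n : 3
    cases n with
    | zero => exact (add_zero (0 : SymPow K 0)).symm
    | succ n => exact map_add (createN n f) (ψ.1 n) (χ.1 n)
  map_smul' c ψ := by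
    ext n : 3
    cases n with
    | zero => exact (smul_zero c : c • (0 : SymPow K 0) = 0).symm
    | succ n => exact map_smul (createN n f) c (ψ.1 n)

/-- Segal's field operator `φ(f) = (a(f) + a(f)*)/√2` on finite-particle vectors. -/
def segalField (f : K) : finiteParticle K →ₗ[ℂ] finiteParticle K :=
  ((Real.sqrt 2)⁻¹ : ℂ) • (annih f + create f)

variable (K) in
theorem dense_finiteParticle : DenseRange (finiteParticle K).subtype := by
  rw [DenseRange, Submodule.coe_subtype, Subtype.range_coe]
  intro ψ
  have h := lp.hasSum_single (E := fun n : ℕ => SymPow K n) (by norm_num : (2 : ENNReal) ≠ ⊤) ψ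
  refine mem_closure_of_tendsto h (Filter.Eventually.of_forall fun s => ?_)
  refine Submodule.sum_mem (finiteParticle K) fun n _ => ?_
  refine (Set.finite_singleton n).subset fun m hm => ?_
  by_contra hne
  exact hm (lp.single_apply_ne 2 n _ hne)

theorem inner_annih_left (f : K) (ψ χ : finiteParticle K) :
    inner ℂ (annih f ψ : Fock K) (χ : Fock K) = inner ℂ (ψ : Fock K) (create f χ : Fock K) := by
  rw [lp.inner_eq_tsum, lp.inner_eq_tsum]
  have hs := lp.summable_inner (𝕜 := ℂ) (ψ : Fock K) (create f χ : Fock K)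
  rw [hs.tsum_eq_zero_add]
  have h0 : ((create f χ : finiteParticle K) : Fock K) 0 = 0 := rfl
  rw [h0, inner_zero_right, zero_add]
  refine tsum_congr fun n => ?_
  exact (ContinuousLinearMap.adjoint_inner_right (annihN n f) (ψ.1 (n + 1)) (χ.1 n)).symm

theorem segalField_symmetric (f : K) (ψ χ : finiteParticle K) :
    inner ℂ (segalField f ψ : Fock K) (χ : Fock K) =
      inner ℂ (ψ : Fock K) (segalField f χ : Fock K) := by
  have h1 := inner_annih_left f ψ χ
  have h2 : inner ℂ (create f ψ : Fock K) (χ : Fock K) =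
      inner ℂ (ψ : Fock K) (annih f χ : Fock K) := by
    rw [← inner_conj_symm, ← inner_annih_left, inner_conj_symm]
  simp only [segalField, LinearMap.smul_apply, LinearMap.add_apply, Submodule.coe_smul,
    Submodule.coe_add, inner_smul_left, inner_smul_right, inner_add_left, inner_add_right, h1, h2]
  rw [← Complex.ofReal_inv, Complex.conj_ofReal, add_comm]

/-- `ψ` has no components with more than `N` particles. -/
def AtMost (N : ℕ) (ψ : finiteParticle K) : Prop := ∀ n, N < n → ψ.1 n = 0

theorem exists_atMost (ψ : finiteParticle K) : ∃ N, AtMost N ψ := by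
  obtain ⟨N, hN⟩ := ψ.2.bddAbove
  exact ⟨N, fun n hn => by
    by_contra h
    exact absurd (hN h) (not_le.mpr hn)⟩

theorem AtMost.segalField {N : ℕ} {ψ : finiteParticle K} (h : AtMost N ψ) (f : K) :
    AtMost (N + 1) (segalField f ψ) := by
  intro n hn
  have h1 : (annih f ψ).1 n = 0 := by
    change annihN n f (ψ.1 (n + 1)) = 0
    rw [h (n + 1) (by omega), map_zero]
  have h2 : (create f ψ).1 n = 0 := by
    cases n with
    | zero => rfl
    | succ n =>
      change createN n f (ψ.1 n) = 0
      rw [h n (by omega), map_zero]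
  change ((Real.sqrt 2)⁻¹ : ℂ) • ((annih f ψ).1 n + (create f ψ).1 n) = 0
  rw [h1, h2]
  simp

theorem norm_sq_eq (ψ : Fock K) : HasSum (fun n => ‖ψ n‖ ^ 2) (‖ψ‖ ^ 2) := by
  have h := lp.hasSum_norm (p := 2) (by norm_num) ψ
  simpa using h

theorem le_of_hasSum_shift {a b : ℕ → ℝ} {A B c : ℝ} (ha : HasSum a A) (hb : HasSum b B)
    (hb0 : 0 ≤ b 0) (hc : 0 ≤ c) (h : ∀ n, a n ≤ c * b (n + 1)) : A ≤ c * B := by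
  have h3 : Summable fun n => b (n + 1) := (summable_nat_add_iff 1).mpr hb.summable
  have h4 : ∑' n, b (n + 1) ≤ B := by
    rw [← hb.tsum_eq, hb.summable.tsum_eq_zero_add]
    exact le_add_of_nonneg_left hb0
  exact (hasSum_le h ha (h3.hasSum.mul_left c)).trans (mul_le_mul_of_nonneg_left h4 hc)

theorem norm_annih_le {N : ℕ} {ψ : finiteParticle K} (h : AtMost N ψ) (f : K) :
    ‖(annih f ψ : Fock K)‖ ≤ Real.sqrt (N + 1) * ‖f‖ * ‖(ψ : Fock K)‖ := by
  refine abs_le_of_sq_le_sq' ?_ (by positivity) |>.2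
  rw [mul_pow _ ‖(ψ : Fock K)‖]
  refine le_of_hasSum_shift (norm_sq_eq (annih f ψ : Fock K)) (norm_sq_eq (ψ : Fock K))
    (sq_nonneg _) (sq_nonneg _) fun n => ?_
  rw [← mul_pow]
  refine pow_le_pow_left₀ (norm_nonneg _) ?_ 2
  change ‖annihN n f (ψ.1 (n + 1))‖ ≤ _
  by_cases hn : n ≤ N
  · refine ((annihN n f).le_opNorm _).trans (mul_le_mul_of_nonneg_right ?_ (norm_nonneg _))
    refine (norm_annihN_le n f).trans (mul_le_mul_of_nonneg_right ?_ (norm_nonneg _))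
    exact Real.sqrt_le_sqrt (by gcongr)
  · have h0 : ψ.1 (n + 1) = 0 := h (n + 1) (by omega)
    rw [h0, map_zero, norm_zero, norm_zero, mul_zero]

theorem norm_create_le {N : ℕ} {ψ : finiteParticle K} (h : AtMost N ψ) (f : K) :
    ‖(create f ψ : Fock K)‖ ≤ Real.sqrt (N + 1) * ‖f‖ * ‖(ψ : Fock K)‖ := by
  refine abs_le_of_sq_le_sq' ?_ (by positivity) |>.2
  have h1 := norm_sq_eq (create f ψ : Fock K)
  have h2 := (norm_sq_eq (ψ : Fock K))
  have h5 : ∀ n, ‖(create f ψ).1 (n + 1)‖ ^ 2 ≤ (Real.sqrt (N + 1) * ‖f‖) ^ 2 * ‖ψ.1 n‖ ^ 2 := by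
    intro n
    rw [← mul_pow]
    refine pow_le_pow_left₀ (norm_nonneg _) ?_ 2
    change ‖createN n f (ψ.1 n)‖ ≤ _
    by_cases hn : n ≤ N
    · refine ((createN n f).le_opNorm _).trans (mul_le_mul_of_nonneg_right ?_ (norm_nonneg _))
      refine (norm_createN_le n f).trans (mul_le_mul_of_nonneg_right ?_ (norm_nonneg _))
      exact Real.sqrt_le_sqrt (by gcongr)
    · rw [h n (by omega)]
      simp
  have h0 : ((create f ψ : finiteParticle K) : Fock K) 0 = 0 := rfl
  have h7 := h1.summable.tsum_eq_zero_add
  rw [h1.tsum_eq, h0] at h7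
  have h6 := ((summable_nat_add_iff 1).mpr h1.summable).tsum_le_tsum h5 (h2.summable.mul_left _)
  rw [tsum_mul_left, h2.tsum_eq] at h6
  calc ‖(create f ψ : Fock K)‖ ^ 2 = _ := h7
    _ ≤ (Real.sqrt (N + 1) * ‖f‖) ^ 2 * ‖ψ.1‖ ^ 2 := by simpa using h6
    _ = _ := by (rw [mul_pow _ ‖(ψ : Fock K)‖])

theorem norm_segalField_le {N : ℕ} {ψ : finiteParticle K} (h : AtMost N ψ) (f : K) :
    ‖(segalField f ψ : Fock K)‖ ≤ 2 * ‖f‖ * Real.sqrt (N + 1) * ‖(ψ : Fock K)‖ := by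
  have h1 := norm_annih_le h f
  have h2 := norm_create_le h f
  have h3 : ‖((Real.sqrt 2)⁻¹ : ℂ)‖ ≤ 1 := by
    rw [← Complex.ofReal_inv, Complex.norm_real, Real.norm_of_nonneg (by positivity)]
    exact inv_le_one_of_one_le₀ (Real.one_le_sqrt.mpr (by norm_num))
  calc ‖(segalField f ψ : Fock K)‖ = ‖((Real.sqrt 2)⁻¹ : ℂ)‖ * ‖(annih f ψ : Fock K) + (create f ψ : Fock K)‖ := norm_smul _ _
    _ ≤ 1 * (‖(annih f ψ : Fock K)‖ + ‖(create f ψ : Fock K)‖) := by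
      gcongr
      exact norm_add_le _ _
    _ ≤ _ := by linarith

/-- The `k`-th term of the exponential series `∑ₖ (iφ(f))ᵏψ/k!`. -/
def expTerm (f : K) (k : ℕ) : finiteParticle K →ₗ[ℂ] finiteParticle K :=
  (Complex.I ^ k / (k.factorial : ℂ)) • (segalField f) ^ k

/-- The bound `(2‖f‖)ᵏ √((N+1)⋯(N+k)) / k!` for the terms of the exponential series. -/
def expBound (c : ℝ) (N k : ℕ) : ℝ := c ^ k * Real.sqrt ((N + 1).ascFactorial k) / k.factorial

theorem atMost_pow {N : ℕ} {ψ : finiteParticle K} (h : AtMost N ψ) (f : K) (k : ℕ) :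
    AtMost (N + k) ((segalField f ^ k) ψ) := by
  induction k with
  | zero => simpa using h
  | succ k ih =>
    rw [pow_succ', Module.End.mul_apply]
    exact ih.segalField f

theorem norm_pow_le {N : ℕ} {ψ : finiteParticle K} (h : AtMost N ψ) (f : K) (k : ℕ) :
    ‖((segalField f ^ k) ψ : Fock K)‖ ≤ (2 * ‖f‖) ^ k * Real.sqrt ((N + 1).ascFactorial k) * ‖(ψ : Fock K)‖ := by
  induction k with
  | zero => simp
  | succ k ih =>
    rw [pow_succ', Module.End.mul_apply]
    refine (norm_segalField_le (atMost_pow h f k) f).trans ?_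
    have h1 : ((N + 1).ascFactorial (k + 1) : ℝ) =
        ((N + k : ℕ) + 1 : ℝ) * ((N + 1).ascFactorial k : ℝ) := by
      rw [Nat.ascFactorial_succ]; push_cast; ring
    rw [h1, Real.sqrt_mul (by positivity), pow_succ]
    calc _ ≤ 2 * ‖f‖ * Real.sqrt ((N + k : ℕ) + 1) *
          ((2 * ‖f‖) ^ k * Real.sqrt ((N + 1).ascFactorial k) * ‖(ψ : Fock K)‖) := by gcongr
      _ = _ := by ring

theorem norm_expTerm_le {N : ℕ} {ψ : finiteParticle K} (h : AtMost N ψ) (f : K) (k : ℕ) :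
    ‖(expTerm f k ψ : Fock K)‖ ≤ expBound (2 * ‖f‖) N k * ‖(ψ : Fock K)‖ := by
  have h1 : ‖(expTerm f k ψ : Fock K)‖ = (k.factorial : ℝ)⁻¹ * ‖((segalField f ^ k) ψ : Fock K)‖ := by
    rw [expTerm, LinearMap.smul_apply, Submodule.coe_smul, norm_smul]
    simp
  rw [h1, expBound]
  calc _ ≤ (k.factorial : ℝ)⁻¹ *
        ((2 * ‖f‖) ^ k * Real.sqrt ((N + 1).ascFactorial k) * ‖(ψ : Fock K)‖) := by
        gcongr; exact norm_pow_le h f k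
    _ = _ := by ring

theorem summable_expBound {c : ℝ} (hc : 0 ≤ c) (N : ℕ) : Summable (expBound c N) := by
  have key : Summable (expBound (c + 1) N) := by
    have hpos : ∀ k, 0 < expBound (c + 1) N k := fun k => by
      unfold expBound
      have : 0 < ((N + 1).ascFactorial k : ℝ) := by exact_mod_cast Nat.ascFactorial_pos _ _
      positivity
    refine summable_of_ratio_test_tendsto_lt_one (l := 0) one_pos
      (Filter.Eventually.of_forall fun k => (hpos k).ne') ?_
    have h1 : ∀ k : ℕ, ‖expBound (c + 1) N (k + 1)‖ / ‖expBound (c + 1) N k‖ =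
        (c + 1) * (Real.sqrt (N + 1 + k) / (k + 1)) := by
      intro k
      rw [Real.norm_of_nonneg (hpos _).le, Real.norm_of_nonneg (hpos _).le]
      unfold expBound
      have h2 : ((N + 1).ascFactorial (k + 1) : ℝ) =
          (N + 1 + k : ℝ) * ((N + 1).ascFactorial k : ℝ) := by
        rw [Nat.ascFactorial_succ]; push_cast; ring
      have h3 : 0 < ((N + 1).ascFactorial k : ℝ) := by exact_mod_cast Nat.ascFactorial_pos _ _
      rw [h2, Real.sqrt_mul (by positivity), Nat.factorial_succ]
      push_cast
      field_simp
      ring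
    simp only [h1]
    rw [show (0 : ℝ) = (c + 1) * 0 by ring]
    refine Filter.Tendsto.const_mul _ ?_
    have h4 : Filter.Tendsto (fun k : ℕ => Real.sqrt ((N + 1 : ℝ) / ((k : ℝ) + 1)))
        Filter.atTop (nhds 0) := by
      have h5 : Filter.Tendsto (fun k : ℕ => (N + 1 : ℝ) * (1 / ((k : ℝ) + 1)))
          Filter.atTop (nhds ((N + 1 : ℝ) * 0)) :=
        tendsto_one_div_add_atTop_nhds_zero_nat.const_mul _
      have h6 := (Real.continuous_sqrt.tendsto _).comp h5
      simpa [Function.comp_def, div_eq_mul_inv] using h6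
    refine squeeze_zero (fun k => by positivity) (fun k => ?_) h4
    refine Real.le_sqrt_of_sq_le ?_
    rw [div_pow, Real.sq_sqrt (by positivity)]
    rw [div_le_div_iff₀ (by positivity) (by positivity)]
    have hk : (0 : ℝ) ≤ k := Nat.cast_nonneg k
    have hN : (0 : ℝ) ≤ N := Nat.cast_nonneg N
    nlinarith [mul_nonneg hk hN, mul_nonneg (mul_nonneg hk hN) hk, mul_nonneg hk hk]
  refine Summable.of_nonneg_of_le (fun k => ?_) (fun k => ?_) key
  · unfold expBound; positivity
  · unfold expBound; gcongr; linarith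

theorem summable_norm_expTerm (f : K) (ψ : finiteParticle K) :
    Summable fun k => ‖((expTerm f k ψ : finiteParticle K) : Fock K)‖ := by
  obtain ⟨N, hN⟩ := exists_atMost ψ
  exact Summable.of_nonneg_of_le (fun k => norm_nonneg _) (fun k => norm_expTerm_le hN f k)
    ((summable_expBound (by positivity) N).mul_right _)

theorem summable_expTerm (f : K) (ψ : finiteParticle K) :
    Summable fun k => ((expTerm f k ψ : finiteParticle K) : Fock K) :=
  (summable_norm_expTerm f ψ).of_norm

/-- The exponential `e^{iφ(f)}ψ = ∑ₖ (iφ(f))ᵏψ/k!` of the field operator on a finite-particle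
vector; the series converges absolutely. -/
def expField (f : K) : finiteParticle K →ₗ[ℂ] Fock K where
  toFun ψ := ∑' k, ((expTerm f k ψ : finiteParticle K) : Fock K)
  map_add' ψ χ := by
    simp only [map_add, Submodule.coe_add]
    exact (summable_expTerm f ψ).tsum_add (summable_expTerm f χ)
  map_smul' c ψ := by
    simp only [map_smul, Submodule.coe_smul, RingHom.id_apply]
    exact (summable_expTerm f ψ).tsum_const_smul c

theorem segalField_pow_symmetric (f : K) (k : ℕ) (ψ χ : finiteParticle K) :
    inner ℂ ((segalField f ^ k) ψ : Fock K) (χ : Fock K) =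
      inner ℂ (ψ : Fock K) ((segalField f ^ k) χ : Fock K) := by
  induction k generalizing χ with
  | zero => simp
  | succ k ih =>
    rw [pow_succ', Module.End.mul_apply, segalField_symmetric, ih, ← Module.End.mul_apply,
      ← pow_succ, pow_succ']

theorem sum_antidiagonal_expTerm (f : K) (ψ χ : finiteParticle K) (n : ℕ) :
    ∑ p ∈ Finset.HasAntidiagonal.antidiagonal n,
      inner ℂ ((expTerm f p.1 ψ : finiteParticle K) : Fock K)
        ((expTerm f p.2 χ : finiteParticle K) : Fock K) =
      if n = 0 then inner ℂ (ψ : Fock K) (χ : Fock K) else 0 := by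
  have h1 : ∀ p ∈ Finset.HasAntidiagonal.antidiagonal n,
      inner ℂ ((expTerm f p.1 ψ : finiteParticle K) : Fock K)
        ((expTerm f p.2 χ : finiteParticle K) : Fock K) =
      (n.choose p.1 • ((-Complex.I) ^ p.1 * Complex.I ^ p.2)) * ((n.factorial : ℂ)⁻¹ *
        inner ℂ (ψ : Fock K) ((segalField f ^ n) χ : Fock K)) := by
    intro p hp
    have hpn : p.1 + p.2 = n := Finset.HasAntidiagonal.mem_antidiagonal.mp hp
    have h2 : inner ℂ (((segalField f) ^ p.1) ψ : Fock K) (((segalField f) ^ p.2) χ : Fock K) =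
        inner ℂ (ψ : Fock K) ((segalField f ^ n) χ : Fock K) := by
      rw [segalField_pow_symmetric, ← Module.End.mul_apply, ← pow_add, hpn]
    have h3 : (n.choose p.1 : ℂ) * (n.factorial : ℂ)⁻¹ =
        (p.1.factorial : ℂ)⁻¹ * (p.2.factorial : ℂ)⁻¹ := by
      have h4 := Nat.choose_mul_factorial_mul_factorial (Nat.le.intro hpn)
      rw [show n - p.1 = p.2 by omega] at h4
      have h5 : (n.choose p.1 : ℂ) * p.1.factorial * p.2.factorial = n.factorial := by
        exact_mod_cast h4
      have e1 : (p.1.factorial : ℂ) ≠ 0 := by exact_mod_cast p.1.factorial_ne_zero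
      have e2 : (p.2.factorial : ℂ) ≠ 0 := by exact_mod_cast p.2.factorial_ne_zero
      have e3 : (n.factorial : ℂ) ≠ 0 := by exact_mod_cast n.factorial_ne_zero
      field_simp
      linear_combination h5
    simp only [expTerm, LinearMap.smul_apply, Submodule.coe_smul, inner_smul_left,
      inner_smul_right, h2, map_div₀, map_pow, Complex.conj_I, map_natCast, nsmul_eq_mul]
    calc _ = ((p.1.factorial : ℂ)⁻¹ * (p.2.factorial : ℂ)⁻¹) *
          ((-Complex.I) ^ p.1 * Complex.I ^ p.2 *
            inner ℂ (ψ : Fock K) ((segalField f ^ n) χ : Fock K)) := by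
          ring
      _ = _ := by rw [← h3]; ring
  rw [Finset.sum_congr rfl h1, ← Finset.sum_mul,
    ← (Commute.all (-Complex.I) Complex.I).add_pow', neg_add_cancel]
  split_ifs with hn
  · subst hn
    simp
  · simp [hn]

theorem tsum_eq_tsum_antidiagonal {g : ℕ × ℕ → ℂ} (hg : Summable g) :
    ∑' p, g p = ∑' n, ∑ p ∈ Finset.HasAntidiagonal.antidiagonal n, g p := by
  have h := (Finset.HasAntidiagonal.sigmaAntidiagonalEquivProd (A := ℕ)).summable_iff.mpr hg
  rw [← (Finset.HasAntidiagonal.sigmaAntidiagonalEquivProd (A := ℕ)).tsum_eq g]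
  refine (h.tsum_sigma' fun n => (hasSum_fintype _).summable).trans (tsum_congr fun n => ?_)
  rw [tsum_fintype]
  exact Finset.sum_coe_sort (Finset.HasAntidiagonal.antidiagonal n) g

theorem inner_expField (f : K) (ψ χ : finiteParticle K) :
    inner ℂ (expField f ψ) (expField f χ) = inner ℂ (ψ : Fock K) (χ : Fock K) := by
  set x : ℕ → Fock K := fun k => (expTerm f k ψ : finiteParticle K) with hx
  set y : ℕ → Fock K := fun k => (expTerm f k χ : finiteParticle K) with hy
  have hxs : Summable x := summable_expTerm f ψ
  have hys : Summable y := summable_expTerm f χ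
  have hsum : Summable fun p : ℕ × ℕ => inner ℂ (x p.1) (y p.2) := by
    refine Summable.of_norm_bounded
      ((summable_norm_expTerm f ψ).mul_of_nonneg (summable_norm_expTerm f χ)
        (fun _ => norm_nonneg _) (fun _ => norm_nonneg _)) fun p => norm_inner_le_norm _ _
  have h1 : ∑' p : ℕ × ℕ, inner ℂ (x p.1) (y p.2) = inner ℂ (expField f ψ) (expField f χ) := by
    rw [hsum.tsum_prod]
    have h2 : ∀ j, ∑' k, inner ℂ (x j) (y k) = inner ℂ (x j) (∑' k, y k) := fun j =>
      ((innerSL ℂ (x j)).map_tsum hys).symm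
    simp only [h2]
    have h3 := (innerSL ℂ (∑' k, y k)).map_tsum hxs
    have h4 : ∑' j, inner ℂ (x j) (∑' k, y k) =
        starRingEnd ℂ (∑' j, inner ℂ (∑' k, y k) (x j)) := by
      rw [Complex.conj_tsum]
      simp
    rw [h4]
    have h5 : ∑' j, inner ℂ (∑' k, y k) (x j) = inner ℂ (∑' k, y k) (∑' k, x k) := h3.symm
    rw [h5, inner_conj_symm]
    rfl
  rw [← h1, tsum_eq_tsum_antidiagonal hsum]
  refine (tsum_congr fun n => sum_antidiagonal_expTerm f ψ χ n).trans ?_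
  exact tsum_ite_eq 0 _

theorem norm_expField (f : K) (ψ : finiteParticle K) : ‖expField f ψ‖ = ‖(ψ : Fock K)‖ := by
  have h := inner_expField f ψ ψ
  rw [inner_self_eq_norm_sq_to_K, inner_self_eq_norm_sq_to_K] at h
  have h' : ‖expField f ψ‖ ^ 2 = ‖(ψ : Fock K)‖ ^ 2 := by exact_mod_cast h
  exact (sq_eq_sq₀ (norm_nonneg _) (norm_nonneg _)).mp h'

/-- The Weyl operator `W(f) = e^{iφ(f)}`: the continuous extension to Fock space of the
exponential series on the finite-particle vectors, which form a dense set of entire analytic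
vectors of the essentially self-adjoint operator `φ(f)`. -/
def weyl (f : K) : Fock K →L[ℂ] Fock K :=
  (expField f).extendOfNorm (finiteParticle K).subtype

theorem weyl_apply (f : K) (ψ : finiteParticle K) : weyl f (ψ : Fock K) = expField f ψ :=
  LinearMap.extendOfNorm_eq (dense_finiteParticle K)
    ⟨1, fun x => by rw [one_mul, norm_expField]; rfl⟩ ψ

end Fock
end BosonFock

namespace PhononBEC

open MeasureTheory BosonFock
open scoped FourierTransform

/-- The one-particle space `L²(ℝᵈ; ℂᴺ)`, in position space. -/
abbrev OneParticle (d N : ℕ) : Type :=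
  Lp (EuclideanSpace ℂ (Fin N)) 2 (volume : Measure (EuclideanSpace ℝ (Fin d)))

/-- The assumptions on the boson dispersion relation `ω(k) = w |k|`. -/
structure IsDispersion (d : ℕ) (β : ℝ) (w : ℝ → ℝ) : Prop where
  nonneg : ∀ k, 0 ≤ k → 0 ≤ w k
  contDiffOn : ContDiffOn ℝ 1 w (Set.Ici 0)
  deriv_pos : ∀ k, 0 ≤ k → 0 < derivWithin w (Set.Ici 0) k
  tendsto_atTop : Filter.Tendsto w Filter.atTop Filter.atTop
  decay : ∃ d₀ : ℝ, (d : ℝ) < d₀ ∧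
    ∃ M : ℝ, ∀ k, 0 ≤ k → (1 + k) ^ d₀ * Real.exp (-β * w k) ≤ M
  infrared : IntegrableOn (fun k : EuclideanSpace ℝ (Fin d) => 1 / (w ‖k‖ - w 0))
    (Metric.closedBall 0 1) volume

variable {d N : ℕ}

/-- The function `k ↦ m(|k|) f̂(k)`, in Mathlib's frequency variable `ξ = k / 2π`. -/
def multiplierFun (m : ℝ → ℝ) (f : OneParticle d N) :
    EuclideanSpace ℝ (Fin d) → EuclideanSpace ℂ (Fin N) :=
  fun ξ => ((m (2 * Real.pi * ‖ξ‖) : ℝ) : ℂ) • (𝓕 f : OneParticle d N) ξ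

/-- `f` is in the domain of `m(|k|)`, the operator of multiplication by `m(|k|)` in momentum
space. -/
def InDomain (m : ℝ → ℝ) (f : OneParticle d N) : Prop :=
  MemLp (multiplierFun m f) 2 volume

open Classical in
/-- The operator of multiplication by `m(|k|)` in momentum space, on its domain (and `0`
outside). -/
def multiplier (m : ℝ → ℝ) (f : OneParticle d N) : OneParticle d N :=
  if h : InDomain m f then 𝓕⁻ (h.toLp (multiplierFun m f)) else 0

/-- Componentwise complex conjugation on `ℂᴺ`. -/
def conjVec (N : ℕ) (z : EuclideanSpace ℂ (Fin N)) : EuclideanSpace ℂ (Fin N) :=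
  WithLp.toLp 2 fun j => starRingEnd ℂ (z j)

theorem lipschitzWith_conjVec (N : ℕ) : LipschitzWith 1 (conjVec N) := by
  refine LipschitzWith.of_dist_le_mul fun x y => ?_
  simp only [EuclideanSpace.dist_eq, conjVec, NNReal.coe_one, one_mul, Complex.dist_conj_conj,
    le_refl]

/-- The conjugation `C f = (f̄₁, …, f̄_N)`, in position space. -/
def conjugation (f : OneParticle d N) : OneParticle d N :=
  (lipschitzWith_conjVec N).compLp (by ext; simp [conjVec]) f

/-- The boson density `ρ = (e^{β(ω - μ)} - 1)⁻¹` as a function of `|k|`. -/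
def density (β μ : ℝ) (w : ℝ → ℝ) (k : ℝ) : ℝ :=
  (Real.exp (β * (w k - μ)) - 1)⁻¹

/-- The space `L¹ ∩ dom (1 - e^{-β(ω - μ)})^{-1/2} ∩ dom ω^{-1/2}` of test functions. -/
def testSpace (d N : ℕ) (β μ : ℝ) (w : ℝ → ℝ) : Set (OneParticle d N) :=
  {f | Integrable f volume ∧
    InDomain (fun k => (Real.sqrt (1 - Real.exp (-β * (w k - μ))))⁻¹) f ∧
    InDomain (fun k => (Real.sqrt (w k))⁻¹) f}

/-- The Araki–Woods Fock space `𝓕_b(L² ⊕ L²)`. -/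
abbrev AWFock (d N : ℕ) : Type := Fock (WithLp 2 (OneParticle d N × OneParticle d N))

/-- The left Araki–Woods Weyl operators `W_{β,l}(f) = e^{iφ((1+ρ)^{1/2} f ⊕ C ρ^{1/2} f)}`. -/
def awWeyl (β μ : ℝ) (w : ℝ → ℝ) (f : OneParticle d N) : AWFock d N →L[ℂ] AWFock d N :=
  weyl (WithLp.toLp 2
    (multiplier (fun k => Real.sqrt (1 + density β μ w k)) f,
      conjugation (multiplier (fun k => Real.sqrt (density β μ w k)) f)))

/-- The zero mode `f̂(0) = (2π)^{-d/2} ∫ f(x) dx`. -/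
def zeroMode (f : OneParticle d N) : EuclideanSpace ℂ (Fin N) :=
  (((2 * Real.pi) ^ (-(d : ℝ) / 2) : ℝ) : ℂ) • ∫ x, f x

/-- The critical density `N (2π)^{-d} ∫ (e^{β(ω(k) - ω(0))} - 1)⁻¹ dk`. -/
def criticalDensity (d N : ℕ) (β : ℝ) (w : ℝ → ℝ) : ℝ :=
  N / (2 * Real.pi) ^ d *
    ∫ k : EuclideanSpace ℝ (Fin d), 1 / (Real.exp (β * (w ‖k‖ - w 0)) - 1)

/-- The constant `c = 2 (2π)^d ρ₀ / N`, where `ρ₀ = ρbar - ρ_c` is the condensate density at total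
density `ρbar`. -/
def condensateConst (d N : ℕ) (β : ℝ) (w : ℝ → ℝ) (ρbar : ℝ) : ℝ :=
  2 * (2 * Real.pi) ^ d * (ρbar - criticalDensity d N β w) / N

/-- The phase `e_f(r, θ) = exp (i √(c r) Re (e^{iθ} z))` with `z` the scalar zero mode of `f`. -/
def phase (c r θ : ℝ) (z : ℂ) : ℂ :=
  Complex.exp (Complex.I *
    ((Real.sqrt (c * r) * (Complex.exp (Complex.I * (θ : ℂ)) * z).re : ℝ) : ℂ))

/-- The operator `π^{r,θ}(W(f)) = e_f(r, θ) W_{β,l}(f)`. The linear functional `ell` turns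
`f̂(0) ∈ ℂᴺ` into a scalar (the identity if `N = 1`). -/
def fiberWeyl (β μ : ℝ) (w : ℝ → ℝ) (ρbar : ℝ) (ell : EuclideanSpace ℂ (Fin N) →ₗ[ℂ] ℂ)
    (r θ : ℝ) (f : OneParticle d N) : AWFock d N →L[ℂ] AWFock d N :=
  phase (condensateConst d N β w ρbar) r θ (ell (zeroMode f)) • awWeyl β μ w f

/-- The *-algebra generated by the Weyl operators `W(f)` on `𝓕_b(L²)`, for test functions `f`. -/
def weylAlgebra (d N : ℕ) (β μ : ℝ) (w : ℝ → ℝ) :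
    StarSubalgebra ℂ (Fock (OneParticle d N) →L[ℂ] Fock (OneParticle d N)) :=
  StarAlgebra.adjoin ℂ (weyl '' testSpace d N β μ w)

/-- The Weyl operator of a test function, as an element of the Weyl algebra. -/
def weylGen {β μ : ℝ} {w : ℝ → ℝ} (f : testSpace d N β μ w) : weylAlgebra d N β μ w :=
  ⟨weyl f.1, StarAlgebra.subset_adjoin ℂ _ ⟨f.1, f.2, rfl⟩⟩

end PhononBEC

end

open PhononBEC

/-! ### Strong continuity of Weyl operators, and its effect on intertwiners -/

noncomputable section

namespace BosonFock

variable {K : Type} [NormedAddCommGroup K] [InnerProductSpace ℂ K]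

open Filter Topology

/-! The two representations share the operators `awWeyl` and differ only in the scalar `phase`,
which sees a test function through its zero mode alone. The point is that the zero mode is not
controlled by the Araki–Woods one-particle norm. Fix `v` and take test functions whose Fourier
transform equals `v` at the origin, up to normalisation, and whose momentum support shrinks to the
origin. All weights involved have squares bounded by `1 + C / (ω - ω(0))`, which is integrable near
zero momentum by the infrared condition. Dominated convergence then sends the Araki–Woods vectors to
`0` in norm (`tendsto_awVector_peak`), so their Weyl operators tend strongly to the identity
(`tendsto_weyl_apply`), while the two phases keep constant values `a` and `b`. An intertwiner `T`
therefore satisfies `a T = b T` in the limit, and vanishes once `a ≠ b` (`eq_zero_of_intertwines`).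
A suitable zero mode with `a ≠ b` exists because distinct polar points give distinct complex numbers
`√(c r) e^{iθ}` (`polar_ne`, `exists_phase_ne`). Disjointness excludes a unitary intertwiner on a
nonzero space, and equivalence of representations of the whole algebra already fails on its
generators. -/

theorem norm_weyl_apply (f : K) (Ψ : Fock K) : ‖weyl f Ψ‖ = ‖Ψ‖ := by
  refine (dense_finiteParticle K).induction_on Ψ ?_ fun ψ => ?_
  · exact isClosed_eq (weyl f).continuous.norm continuous_norm
  · exact (congrArg norm (weyl_apply f ψ)).trans (norm_expField f ψ)

/-- Every term past the zeroth contains a factor `c`. Extracting it makes the remainder of the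
exponential series linear in `c`. -/
theorem expBound_succ_le {c : ℝ} (hc : 0 ≤ c) (hc1 : c ≤ 1) (N k : ℕ) :
    expBound c N (k + 1) ≤ c * expBound 1 N (k + 1) := by
  have h : c ^ (k + 1) ≤ c * 1 ^ (k + 1) := by
    rw [one_pow, mul_one]
    exact pow_le_of_le_one hc hc1 (by simp)
  unfold expBound
  calc _ ≤ c * 1 ^ (k + 1) * Real.sqrt ((N + 1).ascFactorial (k + 1)) / (k + 1).factorial := by
        gcongr
    _ = _ := by ring

/-- The zeroth term of the series is `ψ` itself, and the others are compared with the convergent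
series at `c = 1`. The constant `M` depends on `ψ` but not on `f`. -/
theorem exists_norm_expField_sub_le (ψ : finiteParticle K) :
    ∃ M : ℝ, ∀ f : K, 2 * ‖f‖ ≤ 1 → ‖expField f ψ - (ψ : Fock K)‖ ≤ 2 * ‖f‖ * M := by
  obtain ⟨N, hN⟩ := exists_atMost ψ
  refine ⟨(∑' k, expBound 1 N (k + 1)) * ‖(ψ : Fock K)‖, fun f hf => ?_⟩
  have h0 : expField f ψ - (ψ : Fock K) =
      ∑' k, ((expTerm f (k + 1) ψ : finiteParticle K) : Fock K) := by
    change (∑' k, ((expTerm f k ψ : finiteParticle K) : Fock K)) - _ = _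
    rw [(summable_expTerm f ψ).tsum_eq_zero_add]
    simp [expTerm]
  have hs : Summable fun k => expBound 1 N (k + 1) :=
    (summable_nat_add_iff 1).mpr (summable_expBound zero_le_one N)
  rw [h0]
  refine tsum_of_norm_bounded
    (g := fun k => 2 * ‖f‖ * (expBound 1 N (k + 1) * ‖(ψ : Fock K)‖)) ?_ fun k => ?_
  · exact (hs.hasSum.mul_right _).mul_left _
  · refine (norm_expTerm_le hN f (k + 1)).trans ?_
    rw [← mul_assoc]
    gcongr
    exact expBound_succ_le (by positivity) hf N k

/-- Weyl operators are strongly continuous at the origin of the one-particle space. -/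
theorem tendsto_weyl_apply {g : ℕ → K} (hg : Tendsto g atTop (𝓝 0)) (Ψ : Fock K) :
    Tendsto (fun n => weyl (g n) Ψ) atTop (𝓝 Ψ) := by
  have hfin (ψ : finiteParticle K) :
      Tendsto (fun n => weyl (g n) (ψ : Fock K)) atTop (𝓝 (ψ : Fock K)) := by
    obtain ⟨M, hM⟩ := exists_norm_expField_sub_le ψ
    have hn : Tendsto (fun n => 2 * ‖g n‖) atTop (𝓝 0) := by
      simpa using hg.norm.const_mul 2
    refine tendsto_iff_norm_sub_tendsto_zero.mpr ?_
    refine squeeze_zero' (Eventually.of_forall fun _ => norm_nonneg _) ?_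
      (by simpa using hn.mul_const M)
    filter_upwards [hn.eventually_le_const zero_lt_one] with n h
    rw [weyl_apply]
    exact hM _ h
  -- An `ε/3` argument passes to all of Fock space: Weyl operators are isometric, so the error of
  -- approximating `Ψ` is the same before and after applying them.
  rw [Metric.tendsto_atTop]
  intro ε hε
  obtain ⟨ψ, hψ⟩ := (dense_finiteParticle K).exists_dist_lt Ψ (show 0 < ε / 3 by positivity)
  obtain ⟨n₀, h₀⟩ := Metric.tendsto_atTop.mp (hfin ψ) (ε / 3) (by positivity)
  refine ⟨n₀, fun n hn => ?_⟩
  have h1 : dist (weyl (g n) Ψ) (weyl (g n) (ψ : Fock K)) = dist Ψ (ψ : Fock K) := by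
    rw [dist_eq_norm, ← map_sub, norm_weyl_apply, dist_eq_norm]
  have h2 := h₀ n hn
  have h3 := dist_triangle4 (weyl (g n) Ψ) (weyl (g n) (ψ : Fock K)) (ψ : Fock K) Ψ
  rw [h1, dist_comm (ψ : Fock K) Ψ] at h3
  change dist Ψ (ψ : Fock K) < ε / 3 at hψ
  linarith

/-- The vacuum is a nonzero vector, even if `K = 0`. Without this the zero map could be a unitary.
-/
instance : Nontrivial (Fock K) := by
  have hv : symTprod (K := K) 0 ![] = (1 : ℂ) := by
    rw [symTprod, Fintype.sum_unique]
    rfl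
  have hm : symTprod (K := K) 0 ![] ∈ SymPow K 0 :=
    Submodule.le_topologicalClosure _ (Submodule.subset_span ⟨_, rfl⟩)
  refine ⟨lp.single 2 0 (⟨_, hm⟩ : SymPow K 0), 0, fun h => ?_⟩
  have h1 := congrArg (fun Ψ : Fock K => ((Ψ 0 : SymPow K 0) : TensorPow K 0)) h
  simp only [lp.single_apply_self] at h1
  exact one_ne_zero (α := ℂ) (hv.symm.trans h1)

/-- Intertwiners between two multiples of a family of Weyl operators vanish if the quotient of the
multiples stays away from `1` along a family tending to the identity. -/
theorem eq_zero_of_intertwines {g : ℕ → K} (hg : Tendsto g atTop (𝓝 0)) {a b : ℂ} (hab : a ≠ b)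
    (T : Fock K →L[ℂ] Fock K)
    (hT : ∀ n, T ∘L (a • weyl (g n)) = (b • weyl (g n)) ∘L T) : T = 0 := by
  ext1 Ψ
  have h1 : Tendsto (fun n => a • T (weyl (g n) Ψ)) atTop (𝓝 (a • T Ψ)) :=
    ((T.continuous.tendsto _).comp (tendsto_weyl_apply hg Ψ)).const_smul a
  have h2 : Tendsto (fun n => b • weyl (g n) (T Ψ)) atTop (𝓝 (b • T Ψ)) :=
    (tendsto_weyl_apply hg (T Ψ)).const_smul b
  have h3 : (fun n => a • T (weyl (g n) Ψ)) = fun n => b • weyl (g n) (T Ψ) := by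
    funext n
    simpa using DFunLike.congr_fun (hT n) Ψ
  rw [h3] at h1
  -- The same sequence converges to `a • T Ψ` and to `b • T Ψ`.
  have h4 := tendsto_nhds_unique h1 h2
  rw [← sub_eq_zero, ← sub_smul] at h4
  simpa using (smul_eq_zero.mp h4).resolve_left (sub_ne_zero.mpr hab)

/-- Disjoint families of operators are not unitarily equivalent. -/
theorem not_exists_unitary_of_disjoint {H ι : Type*} [NormedAddCommGroup H]
    [InnerProductSpace ℂ H] [Nontrivial H] {s : Set ι} {A B : ι → H →L[ℂ] H}
    (h : ∀ T : H →L[ℂ] H, (∀ f ∈ s, T ∘L A f = B f ∘L T) → T = 0) :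
    ¬ ∃ U : H ≃ₗᵢ[ℂ] H, ∀ f ∈ s, ∀ Ψ : H, U (A f Ψ) = B f (U Ψ) := by
  rintro ⟨U, hU⟩
  have h0 := h (U.toContinuousLinearEquiv : H →L[ℂ] H) fun f hf =>
    ContinuousLinearMap.ext (hU f hf)
  obtain ⟨Ψ, hΨ⟩ := exists_ne (0 : H)
  exact hΨ (U.map_eq_zero_iff.mp (DFunLike.congr_fun h0 Ψ))

/-- Representations which are inequivalent on some elements are inequivalent. -/
theorem not_exists_unitary_of_generators {H A ι : Type*} [NormedAddCommGroup H]
    [InnerProductSpace ℂ H] [CompleteSpace H] [Semiring A] [Algebra ℂ A] [Star A] {s : Set ι}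
    {X Y : ι → H →L[ℂ] H} {gen : s → A}
    (h : ¬ ∃ U : H ≃ₗᵢ[ℂ] H, ∀ f ∈ s, ∀ Ψ : H, U (X f Ψ) = Y f (U Ψ))
    {π π' : A →⋆ₐ[ℂ] (H →L[ℂ] H)} (hπ : ∀ f : s, π (gen f) = X f.1)
    (hπ' : ∀ f : s, π' (gen f) = Y f.1) :
    ¬ ∃ U : H ≃ₗᵢ[ℂ] H, ∀ a : A, ∀ Ψ : H, U (π a Ψ) = π' a (U Ψ) := by
  rintro ⟨U, hU⟩
  refine h ⟨U, fun f hf Ψ => ?_⟩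
  have h1 := hU (gen ⟨f, hf⟩) Ψ
  rwa [hπ, hπ'] at h1

end BosonFock
end

noncomputable section

namespace PhononBEC

open MeasureTheory BosonFock Filter Topology
open scoped FourierTransform SchwartzMap

variable {d N : ℕ}

/-! ### The dispersion relation near zero momentum -/

namespace IsDispersion

variable {β : ℝ} {w : ℝ → ℝ}

theorem lt_apply (hw : IsDispersion d β w) {k : ℝ} (hk : 0 < k) : w 0 < w k := by
  refine strictMonoOn_of_deriv_pos (convex_Ici 0) hw.contDiffOn.continuousOn (fun x hx => ?_)
    (Set.self_mem_Ici) hk.le hk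
  rw [interior_Ici] at hx
  rw [← derivWithin_of_mem_nhds (Ici_mem_nhds hx)]
  exact hw.deriv_pos x (le_of_lt hx)

theorem continuous_comp_norm (hw : IsDispersion d β w) :
    Continuous fun ξ : EuclideanSpace ℝ (Fin d) => w (2 * Real.pi * ‖ξ‖) :=
  hw.contDiffOn.continuousOn.comp_continuous (by fun_prop)
    fun ξ => by simp only [Set.mem_Ici]; positivity

/-- The substitution `k = 2πξ` carries the infrared condition to the frequency variable, and the
constant `1` is integrable on a ball. This function, times `‖v‖ ^ 2`, is the common majorant for all
weights. -/
theorem integrable_infrared (hw : IsDispersion d β w) (C : ℝ) :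
    Integrable ((Metric.closedBall 0 (1 / (2 * Real.pi))).indicator
      fun ξ : EuclideanSpace ℝ (Fin d) => 1 + C / (w (2 * Real.pi * ‖ξ‖) - w 0)) := by
  have hpi : 0 < 2 * Real.pi := by positivity
  rw [integrable_indicator_iff Metric.isClosed_closedBall.measurableSet]
  refine Integrable.add (integrableOn_const (isCompact_closedBall _ _).measure_lt_top.ne) ?_
  -- Extension by zero turns the condition on the unit ball into integrability on the whole space,
  -- where dilation applies.
  have h1 := ((integrable_indicator_iff Metric.isClosed_closedBall.measurableSet).mpr
    hw.infrared).comp_smul hpi.ne'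
  have h4 := (h1.integrableOn (s := Metric.closedBall 0 (1 / (2 * Real.pi)))).const_mul C
  refine IntegrableOn.congr_fun h4 (fun ξ hξ => ?_) Metric.isClosed_closedBall.measurableSet
  have h2 : ‖(2 * Real.pi) • ξ‖ = 2 * Real.pi * ‖ξ‖ := by
    rw [norm_smul, Real.norm_of_nonneg hpi.le]
  have h3 : (2 * Real.pi) • ξ ∈ Metric.closedBall (0 : EuclideanSpace ℝ (Fin d)) 1 := by
    rw [mem_closedBall_zero_iff] at hξ ⊢
    rw [h2]
    rwa [le_div_iff₀' hpi] at hξ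
  simp only [Set.indicator_of_mem h3, h2]
  ring

end IsDispersion

/-! ### Test functions concentrating at zero momentum -/

/-- A smooth bump at the origin of momentum space with support of radius `1 / (2π(n + 1))`. -/
def momentumBump (d n : ℕ) : ContDiffBump (0 : EuclideanSpace ℝ (Fin d)) where
  rIn := 1 / (2 * Real.pi) / (n + 1) / 2
  rOut := 1 / (2 * Real.pi) / (n + 1)
  rIn_pos := by positivity
  rIn_lt_rOut := half_lt_self (by positivity)

/-- A Schwartz function with value `v` at the origin and support of radius `1 / (2π(n + 1))`. -/
def momentumPeak (d n : ℕ) (v : EuclideanSpace ℂ (Fin N)) :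
    𝓢(EuclideanSpace ℝ (Fin d), EuclideanSpace ℂ (Fin N)) :=
  HasCompactSupport.toSchwartzMap (f := fun ξ => momentumBump d n ξ • v)
    (momentumBump d n).hasCompactSupport.smul_right
    ((momentumBump d n).contDiff.smul contDiff_const)

theorem momentumPeak_zero (n : ℕ) (v : EuclideanSpace ℂ (Fin N)) : momentumPeak d n v 0 = v := by
  change momentumBump d n 0 • v = v
  rw [(momentumBump d n).one_of_mem_closedBall
    (Metric.mem_closedBall_self (momentumBump d n).rIn_pos.le), one_smul]

theorem norm_momentumPeak_le (n : ℕ) (v : EuclideanSpace ℂ (Fin N))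
    (ξ : EuclideanSpace ℝ (Fin d)) : ‖momentumPeak d n v ξ‖ ≤ ‖v‖ := by
  change ‖momentumBump d n ξ • v‖ ≤ ‖v‖
  rw [norm_smul, Real.norm_of_nonneg (momentumBump d n).nonneg]
  exact mul_le_of_le_one_left (norm_nonneg _) (momentumBump d n).le_one

theorem momentumPeak_eq_zero {n : ℕ} (v : EuclideanSpace ℂ (Fin N))
    {ξ : EuclideanSpace ℝ (Fin d)} (hξ : 1 / (2 * Real.pi) / (n + 1) ≤ ‖ξ‖) :
    momentumPeak d n v ξ = 0 := by
  change momentumBump d n ξ • v = 0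
  rw [(momentumBump d n).zero_of_le_dist (by rwa [dist_zero_right]), zero_smul]

/-- The test functions with Fourier transform `momentumPeak d n v`. -/
def peak (d n : ℕ) (v : EuclideanSpace ℂ (Fin N)) : OneParticle d N :=
  (𝓕⁻ (momentumPeak d n v)).toLp 2

theorem integrable_peak (n : ℕ) (v : EuclideanSpace ℂ (Fin N)) : Integrable (peak d n v) :=
  (integrable_congr (SchwartzMap.coeFn_toLp _ _ _)).mpr (SchwartzMap.integrable _)

/-- The integral is the Fourier transform at frequency `0`, which does not change with `n`. -/
theorem integral_peak (n : ℕ) (v : EuclideanSpace ℂ (Fin N)) : ∫ x, peak d n v x = v := by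
  rw [peak, integral_congr_ae (SchwartzMap.coeFn_toLp _ _ _)]
  have h : 𝓕 (𝓕⁻ (momentumPeak d n v)) (0 : EuclideanSpace ℝ (Fin d)) = v := by
    rw [FourierTransform.fourier_fourierInv_eq, momentumPeak_zero]
  rw [SchwartzMap.fourier_coe, Real.fourier_eq] at h
  simpa using h

theorem fourier_peak (n : ℕ) (v : EuclideanSpace ℂ (Fin N)) :
    (𝓕 (peak d n v) : OneParticle d N) =ᵐ[volume] momentumPeak d n v := by
  rw [peak, SchwartzMap.toLp_fourier_eq, FourierTransform.fourier_fourierInv_eq]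
  exact SchwartzMap.coeFn_toLp _ _ _

/-! ### Multipliers on the concentrating test functions -/

/-- Plancherel: the inverse Fourier transform is an isometry of `L²`. -/
theorem norm_multiplier_sq {m : ℝ → ℝ} {f : OneParticle d N} (h : InDomain m f) :
    ‖multiplier m f‖ ^ 2 = ∫ ξ, ‖multiplierFun m f ξ‖ ^ 2 := by
  have h' : MemLp (multiplierFun m f) 2 volume := h
  have h1 : ‖multiplier m f‖ = ‖h'.toLp (multiplierFun m f)‖ := by
    rw [multiplier, dif_pos h]
    exact (Lp.fourierTransformₗᵢ _ _).symm.norm_map _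
  rw [h1, Lp.norm_toLp, h'.eLpNorm_eq_integral_rpow_norm (by norm_num) (by norm_num),
    ENNReal.toReal_ofReal (by positivity)]
  simp only [ENNReal.toReal_ofNat, Real.rpow_ofNat]
  rw [← Real.rpow_natCast, ← Real.rpow_mul (by positivity)]
  simp

section Multiplier

variable {β : ℝ} {w F : ℝ → ℝ} {C : ℝ}

theorem multiplierFun_peak (m : ℝ → ℝ) (n : ℕ) (v : EuclideanSpace ℂ (Fin N)) :
    multiplierFun m (peak d n v) =ᵐ[volume]
      fun ξ => ((m (2 * Real.pi * ‖ξ‖) : ℝ) : ℂ) • momentumPeak d n v ξ := by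
  filter_upwards [fourier_peak n v] with ξ hξ
  rw [multiplierFun, hξ]

/-- The majorant is independent of `n`: all the supports lie in the ball of radius `1 / (2π)`, where
the weight is bounded by `hFC`. The origin is left out because `hFC` needs energies strictly above
`w 0`. -/
theorem norm_multiplierFun_peak_sq_le (hd : 0 < d) (hw : IsDispersion d β w)
    (hFC : ∀ x, w 0 < x → F x ^ 2 ≤ 1 + C / (x - w 0)) (n : ℕ) (v : EuclideanSpace ℂ (Fin N)) :
    ∀ᵐ ξ, ‖multiplierFun (fun k => F (w k)) (peak d n v) ξ‖ ^ 2 ≤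
      (Metric.closedBall 0 (1 / (2 * Real.pi))).indicator
        (fun ξ : EuclideanSpace ℝ (Fin d) => 1 + C / (w (2 * Real.pi * ‖ξ‖) - w 0)) ξ *
        ‖v‖ ^ 2 := by
  -- Positive dimension makes the origin a null set.
  have : Nonempty (Fin d) := ⟨⟨0, hd⟩⟩
  filter_upwards [multiplierFun_peak (fun k => F (w k)) n v,
    compl_mem_ae_iff.mpr (measure_singleton (0 : EuclideanSpace ℝ (Fin d)))] with ξ h hξ
  have hξ0 : 0 < ‖ξ‖ := norm_pos_iff.mpr hξ
  rw [h, norm_smul, Complex.norm_real, mul_pow, Real.norm_eq_abs, sq_abs]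
  by_cases hb : ξ ∈ Metric.closedBall (0 : EuclideanSpace ℝ (Fin d)) (1 / (2 * Real.pi))
  · rw [Set.indicator_of_mem hb]
    have h1 := hFC _ (hw.lt_apply (show 0 < 2 * Real.pi * ‖ξ‖ by positivity))
    exact mul_le_mul h1 (pow_le_pow_left₀ (norm_nonneg _) (norm_momentumPeak_le n v ξ) 2)
      (sq_nonneg _) ((sq_nonneg _).trans h1)
  · rw [Set.indicator_of_notMem hb, momentumPeak_eq_zero]
    · simp
    · rw [mem_closedBall_zero_iff, not_le] at hb
      refine le_trans (div_le_self (by positivity) ?_) hb.le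
      have : (0 : ℝ) ≤ n := n.cast_nonneg
      linarith

/-- Nothing is known of `w` on negative arguments, so measurability passes through the continuity of
`ξ ↦ w (2π‖ξ‖)`. This is why weights are written as functions `F` of the energy. -/
theorem aestronglyMeasurable_multiplierFun (hw : IsDispersion d β w) (hF : Measurable F)
    (f : OneParticle d N) : AEStronglyMeasurable (multiplierFun (fun k => F (w k)) f) volume := by
  have h : Measurable fun ξ : EuclideanSpace ℝ (Fin d) =>
      ((F (w (2 * Real.pi * ‖ξ‖)) : ℝ) : ℂ) :=
    Complex.measurable_ofReal.comp (hF.comp hw.continuous_comp_norm.measurable)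
  exact h.aestronglyMeasurable.smul (Lp.aestronglyMeasurable _)

theorem inDomain_peak (hd : 0 < d) (hw : IsDispersion d β w) (hF : Measurable F)
    (hFC : ∀ x, w 0 < x → F x ^ 2 ≤ 1 + C / (x - w 0)) (n : ℕ) (v : EuclideanSpace ℂ (Fin N)) :
    InDomain (fun k => F (w k)) (peak d n v) := by
  have hm := aestronglyMeasurable_multiplierFun hw hF (peak d n v)
  rw [InDomain, memLp_two_iff_integrable_sq_norm hm]
  refine ((hw.integrable_infrared C).mul_const (‖v‖ ^ 2)).mono' (hm.norm.pow 2) ?_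
  filter_upwards [norm_multiplierFun_peak_sq_le hd hw hFC n v] with ξ h
  rwa [Real.norm_of_nonneg (sq_nonneg _)]

theorem tendsto_multiplier_peak (hd : 0 < d) (hw : IsDispersion d β w) (hF : Measurable F)
    (hFC : ∀ x, w 0 < x → F x ^ 2 ≤ 1 + C / (x - w 0)) (v : EuclideanSpace ℂ (Fin N)) :
    Tendsto (fun n => multiplier (fun k => F (w k)) (peak d n v)) atTop (𝓝 0) := by
  have : Nonempty (Fin d) := ⟨⟨0, hd⟩⟩
  have hsq : Tendsto (fun n => ‖multiplier (fun k => F (w k)) (peak d n v)‖ ^ 2) atTop (𝓝 0) := by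
    -- Membership in the domain ensures that the limit concerns the genuine multiplier and not its
    -- default value `0`.
    simp only [norm_multiplier_sq (inDomain_peak hd hw hF hFC _ v)]
    rw [← integral_zero (EuclideanSpace ℝ (Fin d)) ℝ]
    refine tendsto_integral_of_dominated_convergence _
      (fun n => (aestronglyMeasurable_multiplierFun hw hF (peak d n v)).norm.pow 2)
      ((hw.integrable_infrared C).mul_const (‖v‖ ^ 2)) (fun n => ?_) ?_
    · filter_upwards [norm_multiplierFun_peak_sq_le hd hw hFC n v] with ξ h
      rwa [Real.norm_of_nonneg (sq_nonneg _)]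
    · filter_upwards [ae_all_iff.mpr fun n => multiplierFun_peak (fun k => F (w k)) n v,
        compl_mem_ae_iff.mpr (measure_singleton (0 : EuclideanSpace ℝ (Fin d)))] with ξ h hξ
      have hξ0 : 0 < ‖ξ‖ := norm_pos_iff.mpr hξ
      have hr : Tendsto (fun n : ℕ => 1 / (2 * Real.pi) / ((n : ℝ) + 1)) atTop (𝓝 0) := by
        simpa [div_eq_mul_inv] using
          tendsto_one_div_add_atTop_nhds_zero_nat.const_mul (1 / (2 * Real.pi))
      -- A fixed `ξ ≠ 0` eventually lies outside the shrinking supports, so the integrand is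
      -- eventually zero there.
      refine tendsto_const_nhds.congr' ?_
      filter_upwards [hr.eventually_le_const hξ0] with n hn
      rw [h n, momentumPeak_eq_zero v hn]
      simp
  have h := (Real.continuous_sqrt.tendsto 0).comp hsq
  rw [tendsto_zero_iff_norm_tendsto_zero]
  simpa [Function.comp_def, Real.sqrt_sq] using h

end Multiplier

/-! ### Bounds `1 + C / (x - E)` for the four weights, with `E` the energy at zero momentum -/

section Bounds

variable {β μ E x : ℝ}

/-- This is `e^y - 1 ≥ y`, combined with `x - μ ≥ x - E`. -/
theorem inv_exp_sub_one_le (hβ : 0 < β) (hμ : μ ≤ E) (hx : E < x) :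
    (Real.exp (β * (x - μ)) - 1)⁻¹ ≤ β⁻¹ / (x - E) := by
  have h1 : 0 < β * (x - E) := mul_pos hβ (sub_pos.mpr hx)
  have h2 : β * (x - E) ≤ Real.exp (β * (x - μ)) - 1 := by
    have h3 := Real.add_one_le_exp (β * (x - μ))
    have h4 : β * (x - E) ≤ β * (x - μ) := by gcongr
    linarith
  calc _ ≤ (β * (x - E))⁻¹ := inv_anti₀ h1 h2
    _ = _ := by rw [mul_inv, div_eq_mul_inv]

theorem inv_exp_sub_one_nonneg (hβ : 0 < β) (hμ : μ ≤ E) (hx : E < x) :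
    0 ≤ (Real.exp (β * (x - μ)) - 1)⁻¹ := by
  have : 0 ≤ β * (x - μ) := mul_nonneg hβ.le (by linarith)
  exact inv_nonneg.mpr (sub_nonneg.mpr (Real.one_le_exp this))

theorem sqrt_density_sq_le (hβ : 0 < β) (hμ : μ ≤ E) (hx : E < x) :
    Real.sqrt (Real.exp (β * (x - μ)) - 1)⁻¹ ^ 2 ≤ 1 + β⁻¹ / (x - E) := by
  rw [Real.sq_sqrt (inv_exp_sub_one_nonneg hβ hμ hx)]
  linarith [inv_exp_sub_one_le hβ hμ hx]

theorem sqrt_one_add_density_sq_le (hβ : 0 < β) (hμ : μ ≤ E) (hx : E < x) :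
    Real.sqrt (1 + (Real.exp (β * (x - μ)) - 1)⁻¹) ^ 2 ≤ 1 + β⁻¹ / (x - E) := by
  rw [Real.sq_sqrt (by linarith [inv_exp_sub_one_nonneg hβ hμ hx])]
  linarith [inv_exp_sub_one_le hβ hμ hx]

/-- The identity `(1 - e^{-y})⁻¹ = 1 + (e^y - 1)⁻¹` reduces this weight to `1 + ρ`. -/
theorem inv_sqrt_one_sub_exp_sq_le (hβ : 0 < β) (hμ : μ ≤ E) (hx : E < x) :
    (Real.sqrt (1 - Real.exp (-β * (x - μ))))⁻¹ ^ 2 ≤ 1 + β⁻¹ / (x - E) := by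
  have h0 : 1 < Real.exp (β * (x - μ)) := Real.one_lt_exp_iff.mpr (mul_pos hβ (by linarith))
  have h1 : Real.exp (-β * (x - μ)) = (Real.exp (β * (x - μ)))⁻¹ := by
    rw [neg_mul, Real.exp_neg]
  have h2 : (1 - Real.exp (-β * (x - μ)))⁻¹ = 1 + (Real.exp (β * (x - μ)) - 1)⁻¹ := by
    rw [h1]
    have : Real.exp (β * (x - μ)) - 1 ≠ 0 := by linarith
    field_simp
    ring
  rw [inv_pow, Real.sq_sqrt (by rw [h1]; linarith [inv_le_one_of_one_le₀ h0.le]), h2]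
  linarith [inv_exp_sub_one_le hβ hμ hx]

theorem inv_sqrt_sq_le (hE : 0 ≤ E) (hx : E < x) :
    (Real.sqrt x)⁻¹ ^ 2 ≤ 1 + 1 / (x - E) := by
  rw [inv_pow, Real.sq_sqrt (by linarith), one_div]
  linarith [inv_anti₀ (sub_pos.mpr hx) (show x - E ≤ x by linarith)]

end Bounds

/-! ### Vanishing of the Araki–Woods vectors -/

theorem peak_mem_testSpace (hd : 0 < d) {β μ : ℝ} (hβ : 0 < β) {w : ℝ → ℝ}
    (hw : IsDispersion d β w) (hμ : μ ≤ w 0) (n : ℕ) (v : EuclideanSpace ℂ (Fin N)) :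
    peak d n v ∈ testSpace d N β μ w :=
  ⟨integrable_peak n v,
    inDomain_peak hd hw (F := fun x => (Real.sqrt (1 - Real.exp (-β * (x - μ))))⁻¹)
      (by fun_prop) (fun _ => inv_sqrt_one_sub_exp_sq_le hβ hμ) n v,
    inDomain_peak hd hw (F := fun x => (Real.sqrt x)⁻¹) (by fun_prop)
      (fun _ => inv_sqrt_sq_le (hw.nonneg 0 le_rfl)) n v⟩

/-- The one-particle vector `(1+ρ)^{1/2} f ⊕ C ρ^{1/2} f`. -/
def awVector (β μ : ℝ) (w : ℝ → ℝ) (f : OneParticle d N) :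
    WithLp 2 (OneParticle d N × OneParticle d N) :=
  WithLp.toLp 2
    (multiplier (fun k => Real.sqrt (1 + density β μ w k)) f,
      conjugation (multiplier (fun k => Real.sqrt (density β μ w k)) f))

theorem norm_conjugation_le (f : OneParticle d N) : ‖conjugation f‖ ≤ ‖f‖ := by
  have h := (lipschitzWith_conjVec N).norm_compLp_le (by ext; simp [conjVec]) f
  rw [NNReal.coe_one, one_mul] at h
  exact h

theorem tendsto_awVector_peak (hd : 0 < d) {β μ : ℝ} (hβ : 0 < β) {w : ℝ → ℝ}
    (hw : IsDispersion d β w) (hμ : μ ≤ w 0) (v : EuclideanSpace ℂ (Fin N)) :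
    Tendsto (fun n => awVector β μ w (peak d n v)) atTop (𝓝 0) := by
  have h1 := tendsto_multiplier_peak hd hw
    (F := fun x => Real.sqrt (1 + (Real.exp (β * (x - μ)) - 1)⁻¹))
    (by fun_prop) (fun _ => sqrt_one_add_density_sq_le hβ hμ) v
  have h2 := tendsto_multiplier_peak hd hw
    (F := fun x => Real.sqrt (Real.exp (β * (x - μ)) - 1)⁻¹)
    (by fun_prop) (fun _ => sqrt_density_sq_le hβ hμ) v
  have h3 : Tendsto (fun n => conjugation
      (multiplier (fun k => Real.sqrt (density β μ w k)) (peak d n v))) atTop (𝓝 0) :=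
    -- Conjugation does not increase norms, so the second component also tends to zero.
    squeeze_zero_norm (fun n => norm_conjugation_le _) (tendsto_zero_iff_norm_tendsto_zero.mp h2)
  exact ((WithLp.prod_continuous_toLp 2 (OneParticle d N) (OneParticle d N)).tendsto 0).comp
    (h1.prodMk_nhds h3)

/-! ### Separation of the phases -/

/-- Equal moduli force `r = r'`, as `c > 0`. Equal arguments then make `θ - θ'` a multiple `n · 2π`,
and the range of the angles leaves only `|n| ≤ 1`: `n = 0` contradicts `hne`, and `|n| = 1`
contradicts `hangle`. -/
theorem polar_ne {c r θ r' θ' : ℝ} (hc : 0 < c) (hr : 0 ≤ r) (hr' : 0 ≤ r')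
    (hθ : θ ∈ Set.Icc 0 (2 * Real.pi)) (hθ' : θ' ∈ Set.Icc 0 (2 * Real.pi))
    (hne : (r, θ) ≠ (r', θ')) (hzero : ¬(r = 0 ∧ r' = 0))
    (hangle : ¬(r = r' ∧ |θ - θ'| = 2 * Real.pi)) :
    (Real.sqrt (c * r) : ℂ) * Complex.exp (Complex.I * θ) ≠
      Real.sqrt (c * r') * Complex.exp (Complex.I * θ') := by
  intro h
  have hrr : r = r' := by
    have h1 := congrArg norm h
    rw [norm_mul, norm_mul, mul_comm Complex.I, mul_comm Complex.I,
      Complex.norm_exp_ofReal_mul_I, Complex.norm_exp_ofReal_mul_I, Complex.norm_real,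
      Complex.norm_real, Real.norm_of_nonneg (Real.sqrt_nonneg _),
      Real.norm_of_nonneg (Real.sqrt_nonneg _), mul_one, mul_one,
      Real.sqrt_inj (by positivity) (by positivity)] at h1
    exact mul_left_cancel₀ hc.ne' h1
  subst hrr
  have hr0 : 0 < r := lt_of_le_of_ne hr fun h0 => hzero ⟨h0.symm, h0.symm⟩
  have hs : (Real.sqrt (c * r) : ℂ) ≠ 0 :=
    Complex.ofReal_ne_zero.mpr (Real.sqrt_pos.mpr (mul_pos hc hr0)).ne'
  obtain ⟨n, hn⟩ := Complex.exp_eq_exp_iff_exists_int.mp (mul_left_cancel₀ hs h)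
  have hn' : θ - θ' = n * (2 * Real.pi) := by
    have h1 := congrArg Complex.im hn
    simp at h1
    linarith
  have hpi : 0 < 2 * Real.pi := by positivity
  have hle : |θ - θ'| ≤ 2 * Real.pi := abs_sub_le_iff.mpr
    ⟨by linarith [hθ.2, hθ'.1], by linarith [hθ'.2, hθ.1]⟩
  have habs : |θ - θ'| = |(n : ℝ)| * (2 * Real.pi) := by
    rw [hn', abs_mul, abs_of_pos hpi]
  have hn1 : |(n : ℝ)| ≤ 1 := by
    rw [habs] at hle
    exact le_of_mul_le_mul_right (by linarith) hpi
  have hn2 : |n| ≤ 1 := by exact_mod_cast hn1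
  rcases (abs_nonneg n).eq_or_lt with h0 | h0
  · have : n = 0 := abs_eq_zero.mp h0.symm
    subst this
    refine hne (Prod.ext rfl ?_)
    simp only [Int.cast_zero, zero_mul] at hn'
    exact sub_eq_zero.mp hn'
  · have h1 : |n| = 1 := by omega
    refine hangle ⟨rfl, ?_⟩
    have h2 : |(n : ℝ)| = 1 := by exact_mod_cast h1
    rw [habs, h2, one_mul]

theorem exists_phase_ne {c r θ r' θ' : ℝ}
    (h : (Real.sqrt (c * r) : ℂ) * Complex.exp (Complex.I * θ) ≠
      Real.sqrt (c * r') * Complex.exp (Complex.I * θ')) :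
    ∃ z : ℂ, phase c r θ z ≠ phase c r' θ' z := by
  set a := (Real.sqrt (c * r) : ℂ) * Complex.exp (Complex.I * θ) with ha
  set b := (Real.sqrt (c * r') : ℂ) * Complex.exp (Complex.I * θ') with hb
  have hphase (r θ : ℝ) (z : ℂ) : phase c r θ z = Complex.exp (Complex.I *
      (((Real.sqrt (c * r) : ℂ) * Complex.exp (Complex.I * θ) * z).re : ℝ)) := by
    rw [phase, mul_assoc (Real.sqrt (c * r) : ℂ), Complex.re_ofReal_mul]
  -- This zero mode gives `a z = b z + π`, so the two phases differ by the factor `e^{iπ} = -1`.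
  refine ⟨Real.pi / (a - b), fun heq => ?_⟩
  rw [hphase, hphase, ← ha, ← hb] at heq
  have h1 : a * (Real.pi / (a - b)) = b * (Real.pi / (a - b)) + Real.pi := by
    have := sub_ne_zero.mpr h
    field_simp
    ring
  rw [h1, Complex.add_re, Complex.ofReal_re, Complex.ofReal_add, mul_add, Complex.exp_add,
    mul_comm Complex.I (Real.pi : ℂ), Complex.exp_pi_mul_I] at heq
  have h2 := Complex.exp_ne_zero (Complex.I * ((b * (Real.pi / (a - b))).re : ℝ))
  have h3 : Complex.exp (Complex.I * ((b * (Real.pi / (a - b))).re : ℝ)) * 2 = 0 := by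
    linear_combination -heq
  exact mul_ne_zero h2 two_ne_zero h3

/-- `condensateConst` divides by `N`, so its positivity needs `N ≠ 0`. -/
theorem pos_of_functional_ne_zero {ell : EuclideanSpace ℂ (Fin N) →ₗ[ℂ] ℂ} (hell : ell ≠ 0) :
    0 < N := by
  refine Nat.pos_of_ne_zero fun h0 => hell ?_
  subst h0
  exact LinearMap.ext fun x => by rw [Subsingleton.elim x 0, map_zero, map_zero]

theorem condensateConst_pos {β ρbar : ℝ} {w : ℝ → ℝ} (hN : 0 < N)
    (hρ : criticalDensity d N β w < ρbar) : 0 < condensateConst d N β w ρbar := by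
  have : 0 < ρbar - criticalDensity d N β w := sub_pos.mpr hρ
  unfold condensateConst
  positivity

theorem zeroMode_peak (n : ℕ) (v : EuclideanSpace ℂ (Fin N)) :
    zeroMode (peak d n v) = (((2 * Real.pi) ^ (-(d : ℝ) / 2) : ℝ) : ℂ) • v := by
  rw [zeroMode, integral_peak]

/-- A nonzero functional is surjective, and the factor `(2π)^{-d/2}` can be divided out. A single
`v` serves all `n`, which keeps the phases constant along the sequence. -/
theorem exists_apply_zeroMode_peak (d : ℕ) {ell : EuclideanSpace ℂ (Fin N) →ₗ[ℂ] ℂ}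
    (hell : ell ≠ 0) (z : ℂ) :
    ∃ v : EuclideanSpace ℂ (Fin N), ∀ n, ell (zeroMode (peak d n v)) = z := by
  obtain ⟨v, hv⟩ := LinearMap.surjective hell ((((2 * Real.pi) ^ (-(d : ℝ) / 2) : ℝ) : ℂ)⁻¹ * z)
  have hs : (((2 * Real.pi) ^ (-(d : ℝ) / 2) : ℝ) : ℂ) ≠ 0 :=
    Complex.ofReal_ne_zero.mpr (by positivity)
  refine ⟨v, fun n => ?_⟩
  rw [zeroMode_peak, map_smul, hv, smul_eq_mul, mul_inv_cancel_left₀ hs]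

/-! ### Disjointness and its consequences -/

theorem eq_zero_of_intertwines_fiberWeyl (hd : 0 < d) {β μ ρbar : ℝ} (hβ : 0 < β) {w : ℝ → ℝ}
    (hw : IsDispersion d β w) (hμ : μ ≤ w 0) (hρ : criticalDensity d N β w < ρbar)
    {ell : EuclideanSpace ℂ (Fin N) →ₗ[ℂ] ℂ} (hell : ell ≠ 0)
    {r θ r' θ' : ℝ} (hr : 0 ≤ r) (hr' : 0 ≤ r')
    (hθ : θ ∈ Set.Icc 0 (2 * Real.pi)) (hθ' : θ' ∈ Set.Icc 0 (2 * Real.pi))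
    (hne : (r, θ) ≠ (r', θ')) (hzero : ¬(r = 0 ∧ r' = 0))
    (hangle : ¬(r = r' ∧ |θ - θ'| = 2 * Real.pi))
    (T : AWFock d N →L[ℂ] AWFock d N) (hT : ∀ f ∈ testSpace d N β μ w,
      T ∘L fiberWeyl β μ w ρbar ell r θ f = fiberWeyl β μ w ρbar ell r' θ' f ∘L T) : T = 0 := by
  have hc := condensateConst_pos (β := β) (w := w) (pos_of_functional_ne_zero hell) hρ
  obtain ⟨z, hz⟩ := exists_phase_ne (polar_ne hc hr hr' hθ hθ' hne hzero hangle)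
  obtain ⟨v, hv⟩ := exists_apply_zeroMode_peak d hell z
  refine eq_zero_of_intertwines (tendsto_awVector_peak hd hβ hw hμ v) hz T fun n => ?_
  have h := hT _ (peak_mem_testSpace hd hβ hw hμ n v)
  -- The scalar zero mode is `z` for every `n`, so the phases become the fixed numbers separated by
  -- `hz`.
  simp only [fiberWeyl, hv] at h
  exact h

end PhononBEC

end

theorem mainTheorem6 {d N : ℕ} (hd : 0 < d) {β μ ρbar : ℝ} (hβ : 0 < β) {w : ℝ → ℝ}
    (hw : IsDispersion d β w) (hμ : μ ≤ w 0) (hρ : criticalDensity d N β w < ρbar)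
    (ell : EuclideanSpace ℂ (Fin N) →ₗ[ℂ] ℂ) (hell : ell ≠ 0)
    {r θ r' θ' : ℝ} (hr : 0 ≤ r) (hr' : 0 ≤ r')
    (hθ : θ ∈ Set.Icc 0 (2 * Real.pi)) (hθ' : θ' ∈ Set.Icc 0 (2 * Real.pi))
    (hne : (r, θ) ≠ (r', θ')) (hzero : ¬(r = 0 ∧ r' = 0))
    (hangle : ¬(r = r' ∧ |θ - θ'| = 2 * Real.pi)) :
    (¬ ∃ U : AWFock d N ≃ₗᵢ[ℂ] AWFock d N, ∀ f ∈ testSpace d N β μ w, ∀ Ψ : AWFock d N,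
      U (fiberWeyl β μ w ρbar ell r θ f Ψ) = fiberWeyl β μ w ρbar ell r' θ' f (U Ψ)) ∧
    (∀ T : AWFock d N →L[ℂ] AWFock d N, (∀ f ∈ testSpace d N β μ w,
      T ∘L fiberWeyl β μ w ρbar ell r θ f = fiberWeyl β μ w ρbar ell r' θ' f ∘L T) → T = 0) ∧
    (∀ π π' : weylAlgebra d N β μ w →⋆ₐ[ℂ] (AWFock d N →L[ℂ] AWFock d N),
      (∀ f : testSpace d N β μ w, π (weylGen f) = fiberWeyl β μ w ρbar ell r θ f.1) →
      (∀ f : testSpace d N β μ w, π' (weylGen f) = fiberWeyl β μ w ρbar ell r' θ' f.1) →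
      ¬ ∃ U : AWFock d N ≃ₗᵢ[ℂ] AWFock d N, ∀ A : weylAlgebra d N β μ w, ∀ Ψ : AWFock d N,
        U (π A Ψ) = π' A (U Ψ)) := by
  -- Disjointness is the strongest of the three claims; it yields the inequivalence on generators,
  -- which in turn yields that of the representations.
  have hdisj := eq_zero_of_intertwines_fiberWeyl hd hβ hw hμ hρ hell hr hr' hθ hθ' hne hzero hangle
  have hinequiv := BosonFock.not_exists_unitary_of_disjoint hdisj
  exact ⟨hinequiv, hdisj, fun π π' hπ hπ' =>
    BosonFock.not_exists_unitary_of_generators hinequiv hπ hπ'⟩
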